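/- **Conventions.** For a Polish space $X$, $\Delta(X)$ is the Polish space of Borel probability measures on $X$ (weak topology). For an arbitrary $S\subseteq X$, "$\mu(S)=1$" means that $S$ is measurable for the completion of $\mu$ and has measure one. A *game with bounded payoffs and Polish strategy spaces* consists of Polish spaces $X_1,X_2$ and bounded functions $\pi_i:X_i\times X_j\to\mathbb R$ ($i\in\{1,2\}$, $j$ the other player) such that for every $s\in X_i$ the function $\pi_i(s,\cdot)$ is universally measurable on $X_j$, so that $\pi_i(s,\mu)=\int\pi_i(s,y)\,d\mu(y)$ is defined for $\mu\in\Delta(X_j)$; no joint measurability of $\pi_i$ is required. The game is symmetric if $X_1=X_2$ and $\pi_1=\pi_2$ (own strategy written first). The best response relation $E_i\subseteq X_i\times\Delta(X_j)$ is the set of $(s,\mu)$ with $\pi_i(s,\mu)\ge\pi_i(\bar s,\mu)$ for all $\bar s\in X_i$. *Rationalizability.* Put $X_i^0=X_i$, $X_i^{\alpha+1}=\{s\in X_i^\alpha : (s,\mu)\in E_i \text{ for some } \mu\in\Delta(X_j) \text{ with } \mu(X_j^\alpha)=1\}$, and take intersections at limit ordinals; $\mathrm{RAT}_i=X_i^{\alpha}$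 for the least $\alpha$ with $X_i^{\alpha+1}=X_i^\alpha$ for both $i$. *RCBR.* Let $X_i^{(0)}=X_j$ and $X_i^{(n)}=X_i^{(n-1)}\times\Delta(X_j^{(n-1)})$ be the spaces of uncertainty, and let $T_i^0=\prod_{n>0}\Delta(X_i^{(n-1)})$. A sequence $\delta=(\delta^1,\delta^2,\dots)\in T_i^0$ is coherent if the marginal of $\delta^{n+1}$ on $X_i^{(n-1)}$ is $\delta^{n}$ for all $n\ge1$; then $\lambda_i(\delta)$ is the unique probability measure on $X_j\times T_j^0$ whose marginal on $X_i^{(n)}$ is $\delta^{n+1}$ for every $n\ge0$. Let $T_i^1$ be the set of coherent sequences, $T_i^{k+1}=\{\delta\in T_i^1:\lambda_i(\delta)(X_j\times T_j^{k})=1\}$, and let the universal type space be $T_i=\bigcap_{k\geq 1} T_i^k$. Let $R_i^1$ be the set of $(s,t)\in X_i\times T_i$ with $(s,\mathrm{marg}_{X_j}\lambda_i(t))\in E_i$, and $R_i^{n+1}=\{(s,t)\in R_i^n:\lambda_i(t)(R_j^n)=1\}$. Then $\mathrm{RCBR}_i$ is the set of $s\in X_i$ for which there is $t\in T_i$ with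 $(s,t)\in R_i^n$ for all $n\ge1$; such strategies are called consistent with Rationality and Common Belief in Rationality. **Theorem.** (1) If $\mathrm{RAT}_i=\mathrm{RCBR}_i$ for both players $i$ in every game with bounded payoffs and Polish strategy spaces, then every $A\subseteq\mathbb R$ is Lebesgue measurable. (2) More precisely, let $A\subseteq[0,1]$ be arbitrary and let $\mu_0$ be Lebesgue measure on $[0,1]$, regarded as a measure on $[0,2]$. There is a symmetric game with bounded payoffs on $X_1=X_2=[0,2]$, each $\pi_i(x,\cdot)$ being Borel measurable, such that for both players $$E_i=\{(x,\mu_0): x\in[0,1]\setminus A\}\cup\{(x,\delta_1): x\in A\},\qquad \mathrm{RAT}_i=[0,1],$$ and such that, if some strategy $x\in[0,1]\setminus A$ (for example $x=0$, when $0\notin A$) is consistent with RCBR for player $i$, then there is $\nu\in\Delta([0,2]\times\Delta([0,2]))$ with $\mathrm{marg}_{[0,2]}\,\nu=\mu_0$ and $\nu(E_j)=1$, and $A$ is Lebesgue measurable. -/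

import Mathlib

open MeasureTheory Set

/-- The two players of a strategic form game. -/
inductive Player
  | one
  | two

/-- The opponent of a player. -/
def Player.other : Player → Player
  | .one => .two
  | .two => .one

/-- The completion of the measure `μ` gives the set `S` measure one: `S` is measurable for the
completion of `μ` and has full measure. -/
def Concentrates {Ω : Type*} [MeasurableSpace Ω] (μ : ProbabilityMeasure Ω) (S : Set Ω) : Prop :=
  NullMeasurableSet S (μ : Measure Ω) ∧ (μ : Measure Ω) S = 1

/-- A two-person strategic form game with bounded payoffs on the strategy spaces `X i`.
The payoff of player `i` is written as a function of the player's own strategy (first) and of the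
opponent's strategy (second). For each fixed own strategy the payoff is a universally measurable
function of the opponent's strategy, so that it has an expectation under every belief.
No joint measurability in the two strategies is imposed. -/
structure Game (X : Player → Type) [∀ i, MeasurableSpace (X i)] where
  payoff : ∀ i : Player, X i → X i.other → ℝ
  bounded : ∀ i, ∃ C : ℝ, ∀ s t, |payoff i s t| ≤ C
  section_measurable : ∀ (i : Player) (s : X i) (μ : ProbabilityMeasure (X i.other)),
    NullMeasurable (payoff i s) (μ : Measure (X i.other))

section Hierarchies

variable (X : Player → Type) [∀ i, MeasurableSpace (X i)]

/-- The spaces of uncertainty of the players: at order `0` the opponent's strategies, and at order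
`n + 1` the product of the space of order `n` with the opponent's beliefs about the opponent's own
space of uncertainty of order `n`. A space of probability measures carries the σ-algebra generated
by the evaluations `μ ↦ μ B`; over a Polish space this is the Borel σ-algebra of the weak
topology. -/
noncomputable def uncertaintySpace : ℕ → Player → MeasCat.{0}
  | 0, i => MeasCat.of (X i.other)
  | n + 1, i => MeasCat.of
      (uncertaintySpace n i × ProbabilityMeasure (uncertaintySpace n i.other))

/-- Sequences of beliefs of player `i`, one of each order: the term with index `n` is the
player's belief of order `n + 1`. -/
abbrev Hierarchy (i : Player) : Type :=
  ∀ n : ℕ, ProbabilityMeasure (uncertaintySpace X n i)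

variable {X}

/-- Forget the last coordinate of a point of the space of uncertainty of order `n + 1`. -/
def forgetLast (i : Player) (n : ℕ) :
    uncertaintySpace X (n + 1) i → uncertaintySpace X n i :=
  fun p => Prod.fst p

/-- The beliefs of different orders agree on the common coordinates. -/
def Coherent {i : Player} (δ : Hierarchy X i) : Prop :=
  ∀ n : ℕ, (δ (n + 1) : Measure (uncertaintySpace X (n + 1) i)).map (forgetLast i n) =
    (δ n : Measure (uncertaintySpace X n i))

/-- The projection `(s, δ) ↦ (s, δ¹, …, δⁿ)` to the space of uncertainty of order `n` of player
`i`, where `s` is a strategy and `δ` a sequence of beliefs of the opponent. -/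
def truncation (i : Player) :
    ∀ n : ℕ, X i.other × Hierarchy X i.other → uncertaintySpace X n i
  | 0 => fun p => p.1
  | n + 1 => fun p => (truncation i n p, p.2 n)

/-- `IsLambda δ ν` says that `ν` is the Kolmogorov extension of the sequence of beliefs `δ`: the
probability measure on the opponent's strategies and sequences of beliefs whose marginals are the
beliefs `δ n`. It is the graph of the map `δ ↦ λᵢ(δ)`: such a `ν` is unique, since the marginals
determine it on cylinder sets, and over Polish strategy spaces it exists for all coherent `δ`. -/
def IsLambda {i : Player} (δ : Hierarchy X i)
    (ν : ProbabilityMeasure (X i.other × Hierarchy X i.other)) : Prop :=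
  ∀ n : ℕ, (ν : Measure (X i.other × Hierarchy X i.other)).map (truncation i n) =
    (δ n : Measure (uncertaintySpace X n i))

/-- The decreasing stages in the construction of the universal type spaces: first the coherent
sequences of beliefs, then repeatedly those coherent sequences whose extension concentrates on
the sequences of the opponent in the previous stage. -/
def typeStage : ℕ → ∀ i : Player, Set (Hierarchy X i)
  | 0, _ => {δ | Coherent δ}
  | k + 1, i => {δ | Coherent δ ∧ ∃ ν : ProbabilityMeasure (X i.other × Hierarchy X i.other),
      IsLambda δ ν ∧ Concentrates ν {p | p.2 ∈ typeStage k i.other}}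

/-- The universal type space of player `i`, as a set of sequences of beliefs. -/
def typeSpace (i : Player) : Set (Hierarchy X i) := ⋂ k, typeStage k i

/-- For relations `E i` between strategies and beliefs, `epistemicStage E n i` is the set of pairs
`(s, t)` of a strategy and a type of player `i` that satisfy "`E` and belief in `E`" to the order
`n + 1`. At order one, `s` stands in the relation `E i` to the marginal of `λᵢ(t)` on the
opponent's strategies; at each further order, moreover, `λᵢ(t)` gives measure one to the previous
set of the opponent. -/
def epistemicStage (E : ∀ i : Player, Set (X i × ProbabilityMeasure (X i.other))) :
    ℕ → ∀ i : Player, Set (X i × Hierarchy X i)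
  | 0, i => {p | p.2 ∈ typeSpace i ∧
      ∃ ν : ProbabilityMeasure (X i.other × Hierarchy X i.other),
        IsLambda p.2 ν ∧ (p.1, ν.map measurable_fst.aemeasurable) ∈ E i}
  | n + 1, i => {p | p ∈ epistemicStage E n i ∧
      ∃ ν : ProbabilityMeasure (X i.other × Hierarchy X i.other),
        IsLambda p.2 ν ∧ Concentrates ν (epistemicStage E n i.other)}

end Hierarchies

namespace Game

variable {X : Player → Type} [∀ i, MeasurableSpace (X i)] (G : Game X)

/-- The expected payoff of the strategy `s` of player `i` under the belief `μ`. -/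
noncomputable def expectedPayoff (i : Player) (s : X i)
    (μ : ProbabilityMeasure (X i.other)) : ℝ :=
  ∫ y, G.payoff i s y ∂(μ : Measure (X i.other))

/-- The best response relation of player `i`: the pairs `(s, μ)` such that `s` is a best response,
among all strategies of player `i`, to the belief `μ`. -/
def bestResponse (i : Player) : Set (X i × ProbabilityMeasure (X i.other)) :=
  {p | ∀ t : X i, G.expectedPayoff i t p.2 ≤ G.expectedPayoff i p.1 p.2}

/-- The strategies that survive to stage `α` of the transfinite iterated deletion of strategies
that are not a best response to any belief concentrated on the opponent's surviving strategies. -/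
noncomputable def survivors (α : Ordinal.{0}) : ∀ i : Player, Set (X i) :=
  Ordinal.limitRecOn (motive := fun _ => ∀ i : Player, Set (X i)) α
    (fun _ => univ)
    (fun _ S i => {s | s ∈ S i ∧ ∃ μ : ProbabilityMeasure (X i.other),
      Concentrates μ (S i.other) ∧ (s, μ) ∈ G.bestResponse i})
    (fun α _ S i => ⋂ (β : Ordinal.{0}) (h : β < α), S β h i)

/-- The rationalizable strategies: those that survive to the first stage at which neither player
loses a strategy in the next round. -/
noncomputable def rationalizable (i : Player) : Set (X i) :=
  G.survivors (sInf {α : Ordinal.{0} | ∀ j, G.survivors (α + 1) j = G.survivors α j}) i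

/-- The strategies of player `i` that are consistent with Rationality and Common Belief in
Rationality, as witnessed by a single type. -/
def rcbr (i : Player) : Set (X i) :=
  {s | ∃ t : Hierarchy X i, ∀ n : ℕ, (s, t) ∈ epistemicStage G.bestResponse n i}

end Game

/-! The game encodes `A` in its best responses: strategies in `A` are justified only by the point
mass at `1`, those in `[0, 1] \ A` only by Lebesgue measure, and those in `(1, 2]` are penalized
tests that exclude all other beliefs (`isIndicatorGame_indicatorGame`). Iterated deletion chooses a
belief separately for each strategy, so all of `[0, 1]` survives.

RCBR instead asks for one measure `ν` on the opponent's strategies and hierarchies. For a strategy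
outside `A`, its first marginal is Lebesgue, and almost surely the opponent's first-order belief
justifies the opponent's strategy. That belief takes two distinct values, which cut a Borel set of
full measure into two Borel pieces projecting into `[0, 1] \ A` and into `A`. The projections
contain Borel sets `C` and `D` that together still carry the marginal
(`exists_measurableSet_subset_image`), so `A` differs from `D` by a null set. The projection
argument uses compact inner regularity, hence needs hierarchies to form a standard Borel space
(`standardBorelSpace_probabilityMeasure`). -/

/-! ### Standard Borel spaces of measures and projections -/

/-- A measurable retract of a standard Borel space is standard Borel. -/
theorem StandardBorelSpace.of_leftInverse {α β : Type*} [MeasurableSpace α] [MeasurableSpace β]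
    [StandardBorelSpace β] {f : α → β} {g : β → α} (hf : Measurable f) (hg : Measurable g)
    (h : Function.LeftInverse g f) : StandardBorelSpace α := by
  have hrange : MeasurableSet {b | f (g b) = b} :=
    measurableSet_eq_fun (hf.comp hg) measurable_id
  -- The set of fixed points of `f ∘ g` is the range of `f`; a suitable Polish topology with the
  -- same Borel sets makes it closed.
  obtain ⟨_, _, _, hclosed, _⟩ := hrange.isClopenable'
  have := hclosed.polishSpace
  let e : α ≃ {b | f (g b) = b} :=
    { toFun := fun a => ⟨f a, congrArg f (h a)⟩
      invFun := fun b => g b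
      left_inv := h
      right_inv := fun b => Subtype.ext b.2 }
  let τ : TopologicalSpace α := TopologicalSpace.induced e inferInstance
  have hpolish : PolishSpace α := e.polishSpace_induced
  refine ⟨τ, ⟨?_⟩, hpolish⟩
  have hborel : borel α = MeasurableSpace.comap e inferInstance := by
    rw [BorelSpace.measurable_eq (α := {b | f (g b) = b})]
    exact borel_comap
  rw [hborel]
  refine le_antisymm (fun s hs => ?_) (hf.subtype_mk).comap_le
  refine ⟨(fun b => g b) ⁻¹' s, (hg.comp measurable_subtype_coe) hs, ?_⟩
  ext a
  exact iff_of_eq (congrArg (· ∈ s) (h a))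

open ProbabilityTheory in
theorem isRatStieltjesPoint_cdf (μ : Measure ℝ) (g : ℚ → ℝ) (hg : ∀ q, g q = cdf μ q) :
    IsRatStieltjesPoint (id : (ℚ → ℝ) → ℚ → ℝ) g where
  mono := fun q r hqr => by
    simpa only [id, hg] using monotone_cdf μ (Rat.cast_le.2 hqr)
  tendsto_atTop_one := by
    simp only [id, funext hg]
    exact (tendsto_cdf_atTop μ).comp (tendsto_ratCast_atTop_iff.2 Filter.tendsto_id)
  tendsto_atBot_zero := by
    simp only [id, funext hg]
    exact (tendsto_cdf_atBot μ).comp (tendsto_ratCast_atBot_iff.2 Filter.tendsto_id)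
  iInf_rat_gt_eq := fun t => by
    simp only [id, hg]
    rw [← StieltjesFunction.iInf_rat_gt_eq (cdf μ) t]
    exact Equiv.iInf_congr (Equiv.subtypeEquivRight fun r => by simp) fun r => rfl

-- `stieltjesOfMeasurableRat` substitutes a default at points that are not rational traces of a cdf;
-- genuine traces avoid the default, and right continuity recovers the cdf from them.
open ProbabilityTheory in
theorem measure_stieltjesOfMeasurableRat_cdf (μ : Measure ℝ) [IsProbabilityMeasure μ] (g : ℚ → ℝ)
    (hg : ∀ q, g q = cdf μ q) :
    (stieltjesOfMeasurableRat (id : (ℚ → ℝ) → ℚ → ℝ) measurable_id g).measure = μ := by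
  conv_rhs => rw [← measure_cdf μ]
  congr 1
  ext x
  rw [← StieltjesFunction.iInf_rat_gt_eq, ← StieltjesFunction.iInf_rat_gt_eq (cdf μ)]
  congr 1 with q
  rw [stieltjesOfMeasurableRat_eq, toRatCDF_of_isRatStieltjesPoint (isRatStieltjesPoint_cdf μ g hg)]
  exact hg q

open ProbabilityTheory in
/-- The probability measures on a standard Borel space form a standard Borel space. -/
instance standardBorelSpace_probabilityMeasure {Ω : Type*} [MeasurableSpace Ω]
    [StandardBorelSpace Ω] : StandardBorelSpace (ProbabilityMeasure Ω) := by
  cases isEmpty_or_nonempty Ω with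
  | inl h =>
    have : IsEmpty (ProbabilityMeasure Ω) :=
      ⟨fun μ => not_isEmpty_iff.2 (μ : Measure Ω).nonempty_of_neZero h⟩
    infer_instance
  | inr h =>
    have he := measurableEmbedding_embeddingReal Ω
    obtain ⟨r, hr, hre⟩ := he.exists_measurable_extend measurable_id (fun _ => h)
    have hcdf : ∀ (μ : ProbabilityMeasure Ω) (x : ℝ),
        cdf ((μ : Measure Ω).map (embeddingReal Ω)) x =
          (μ : Measure Ω).real (embeddingReal Ω ⁻¹' Iic x) := fun μ x => by
      have := Measure.isProbabilityMeasure_map (μ := (μ : Measure Ω)) he.measurable.aemeasurable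
      rw [cdf_eq_real, map_measureReal_apply he.measurable measurableSet_Iic]
    -- Encode a measure by the rational cdf values of its image in `ℝ`; decode by rebuilding the
    -- real measure and pushing it back along `r`.
    refine StandardBorelSpace.of_leftInverse (β := ℚ → ℝ)
      (f := fun μ q => (μ : Measure Ω).real (embeddingReal Ω ⁻¹' Iic (q : ℝ)))
      (g := fun x => ⟨(stieltjesOfMeasurableRat id measurable_id x).measure.map r,
        Measure.isProbabilityMeasure_map hr.aemeasurable⟩) ?_ ?_ ?_
    · refine measurable_pi_lambda _ fun q => ?_
      exact ((Measure.measurable_coe (he.measurable measurableSet_Iic)).comp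
        measurable_subtype_coe).ennreal_toReal
    · exact ((Measure.measurable_map r hr).comp
        (measurable_measure_stieltjesOfMeasurableRat measurable_id)).subtype_mk
    · intro μ
      have := Measure.isProbabilityMeasure_map (μ := (μ : Measure Ω)) he.measurable.aemeasurable
      apply Subtype.ext
      change Measure.map r _ = (μ : Measure Ω)
      rw [measure_stieltjesOfMeasurableRat_cdf _ _ fun q => (hcdf μ q).symm,
        Measure.map_map hr he.measurable, hre, Measure.map_id]

instance standardBorelSpace_uncertaintySpace (X : Player → Type) [∀ i, MeasurableSpace (X i)]
    [∀ i, StandardBorelSpace (X i)] : ∀ n i, StandardBorelSpace (uncertaintySpace X n i)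
  | 0, i => inferInstanceAs (StandardBorelSpace (X i.other))
  | n + 1, i =>
    have := standardBorelSpace_uncertaintySpace X n i
    have := standardBorelSpace_uncertaintySpace X n i.other
    inferInstanceAs (StandardBorelSpace
      (uncertaintySpace X n i × ProbabilityMeasure (uncertaintySpace X n i.other)))

/-- A measurable subset of a standard Borel space is, up to a null set, mapped by a measurable map
onto a measurable subset of its image. -/
theorem exists_measurableSet_subset_image {Ω Y : Type*} [MeasurableSpace Ω] [StandardBorelSpace Ω]
    [MeasurableSpace Y] [StandardBorelSpace Y] (μ : Measure (Y × Ω)) [IsFiniteMeasure μ]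
    {B : Set (Y × Ω)} (hB : MeasurableSet B) :
    ∃ C ⊆ Prod.fst '' B, MeasurableSet C ∧ μ (B \ Prod.fst ⁻¹' C) = 0 := by
  let := upgradeStandardBorel Ω
  let := upgradeStandardBorel Y
  -- The image of `B` is only analytic, but compact sets have compact images. At `n = 0` the error
  -- is `∞`, which is harmless.
  have h : ∀ n : ℕ, ∃ K ⊆ B, IsCompact K ∧ μ B < μ K + (n : ENNReal)⁻¹ := fun n =>
    hB.exists_isCompact_lt_add (measure_ne_top _ _) (by simp)
  choose K hKB hK hμ using h
  refine ⟨⋃ n, Prod.fst '' K n, iUnion_subset fun n => image_mono (hKB n),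
    MeasurableSet.iUnion fun n => ((hK n).image continuous_fst).measurableSet, ?_⟩
  refine le_antisymm (ENNReal.le_of_forall_pos_le_add fun ε hε _ => ?_) zero_le
  obtain ⟨n, hn⟩ := ENNReal.exists_inv_nat_lt (ENNReal.coe_ne_zero.2 hε.ne')
  rw [zero_add]
  refine le_trans ?_ hn.le
  calc μ (B \ Prod.fst ⁻¹' ⋃ n, Prod.fst '' K n)
      ≤ μ (B \ K n) := measure_mono fun p hp =>
        ⟨hp.1, fun hpK => hp.2 (mem_iUnion.2 ⟨n, mem_image_of_mem _ hpK⟩)⟩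
    _ = μ B - μ (K n) :=
        measure_sdiff (hKB n) (hK n).measurableSet.nullMeasurableSet (measure_ne_top _ _)
    _ ≤ (n : ENNReal)⁻¹ := tsub_le_iff_left.2 (hμ n).le

/-! ### Concentration and first-order beliefs -/

/-- Subsets of null sets are measurable for the completion, so the larger set may be arbitrary. -/
theorem Concentrates.mono {Ω : Type*} [MeasurableSpace Ω] {μ : ProbabilityMeasure Ω} {S T : Set Ω}
    (h : Concentrates μ S) (hST : S ⊆ T) : Concentrates μ T := by
  have hS : (μ : Measure Ω) Sᶜ = 0 := (prob_compl_eq_zero_iff₀ h.1).2 h.2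
  have hT : (μ : Measure Ω) Tᶜ = 0 := measure_mono_null (compl_subset_compl.2 hST) hS
  have hT' : NullMeasurableSet T (μ : Measure Ω) := (NullMeasurableSet.of_null hT).of_compl
  exact ⟨hT', (prob_compl_eq_zero_iff₀ hT').1 hT⟩

theorem concentrates_of_measure_compl_eq_zero {Ω : Type*} [MeasurableSpace Ω]
    {μ : ProbabilityMeasure Ω} {S : Set Ω} (h : (μ : Measure Ω) Sᶜ = 0) : Concentrates μ S :=
  have hS : NullMeasurableSet S (μ : Measure Ω) := (NullMeasurableSet.of_null h).of_compl
  ⟨hS, (prob_compl_eq_zero_iff₀ hS).1 h⟩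

section FirstOrder

variable {X : Player → Type} [∀ i, MeasurableSpace (X i)]

/-- The belief of player `i` about the strategy of the opponent. -/
def Hierarchy.firstOrder {i : Player} (δ : Hierarchy X i) : ProbabilityMeasure (X i.other) := δ 0

theorem measurable_firstOrder {i : Player} :
    Measurable (Hierarchy.firstOrder : Hierarchy X i → ProbabilityMeasure (X i.other)) :=
  measurable_pi_apply 0

theorem IsLambda.map_fst {i : Player} {δ : Hierarchy X i}
    {ν : ProbabilityMeasure (X i.other × Hierarchy X i.other)} (h : IsLambda δ ν) :
    ν.map measurable_fst.aemeasurable = δ.firstOrder :=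
  Subtype.ext (h 0)

/-- A strategy that is consistent with rationality and belief in rationality is a best response to
the first marginal of a probability measure on strategies and hierarchies of the opponent that
concentrates on the strategies that are best responses to the first-order beliefs. -/
theorem Game.exists_concentrates_of_mem_rcbr {G : Game X} {i : Player} {s : X i}
    (hs : s ∈ G.rcbr i) :
    ∃ ν : ProbabilityMeasure (X i.other × Hierarchy X i.other),
      (s, ν.map measurable_fst.aemeasurable) ∈ G.bestResponse i ∧
      Concentrates ν {p | (p.1, p.2.firstOrder) ∈ G.bestResponse i.other} := by
  obtain ⟨t, ht⟩ := hs
  -- Two orders of RCBR suffice. The extensions `ν₀` and `ν` need not be identified: both have the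
  -- first-order belief of `t` as marginal.
  obtain ⟨-, ν₀, hν₀, hE⟩ := ht 0
  obtain ⟨-, ν, hν, hC⟩ := ht 1
  refine ⟨ν, ?_, hC.mono ?_⟩
  · rw [hν.map_fst, ← hν₀.map_fst]
    exact hE
  · rintro p ⟨-, ν', hν', hp⟩
    rw [hν'.map_fst] at hp
    exact hp

end FirstOrder

/-! ### The two justifying beliefs -/

/-- Lebesgue measure on the unit interval as a probability measure on the interval `[0, 2]`. -/
noncomputable def unitLebesgue : ProbabilityMeasure (Icc (0 : ℝ) 2) :=
  ⟨(volume.restrict (Icc 0 1)).comap Subtype.val, by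
    refine ⟨?_⟩
    rw [(MeasurableEmbedding.subtype_coe measurableSet_Icc).comap_apply, image_univ,
      Subtype.range_coe, Measure.restrict_apply measurableSet_Icc,
      inter_eq_right.2 (Icc_subset_Icc_right one_le_two)]
    simp⟩

theorem map_val_unitLebesgue :
    (unitLebesgue : Measure (Icc (0 : ℝ) 2)).map Subtype.val = volume.restrict (Icc 0 1) := by
  change Measure.map _ (Measure.comap _ _) = _
  rw [(MeasurableEmbedding.subtype_coe measurableSet_Icc).map_comap, Subtype.range_coe,
    Measure.restrict_restrict measurableSet_Icc,
    inter_eq_right.2 (Icc_subset_Icc_right one_le_two)]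

/-- The point mass at `1`, as a probability measure on the interval `[0, 2]`. -/
noncomputable def diracOne : ProbabilityMeasure (Icc (0 : ℝ) 2) :=
  ⟨Measure.dirac ⟨1, mem_Icc.2 ⟨zero_le_one, one_le_two⟩⟩, inferInstance⟩

theorem map_val_diracOne :
    (diracOne : Measure (Icc (0 : ℝ) 2)).map Subtype.val = Measure.dirac 1 :=
  Measure.map_dirac' measurable_subtype_coe _

theorem map_val_injective {μ ν : ProbabilityMeasure (Icc (0 : ℝ) 2)}
    (h : (μ : Measure (Icc (0 : ℝ) 2)).map Subtype.val =
      (ν : Measure (Icc (0 : ℝ) 2)).map Subtype.val) :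
    μ = ν := by
  have he := MeasurableEmbedding.subtype_coe (measurableSet_Icc (a := (0 : ℝ)) (b := 2))
  apply Subtype.ext
  change (μ : Measure (Icc (0 : ℝ) 2)) = ν
  rw [← he.comap_map (μ : Measure (Icc (0 : ℝ) 2)), h, he.comap_map]

theorem concentrates_unitLebesgue :
    Concentrates unitLebesgue {x : Icc (0 : ℝ) 2 | (x : ℝ) ∈ Icc 0 1} := by
  apply concentrates_of_measure_compl_eq_zero
  have : (unitLebesgue : Measure (Icc (0 : ℝ) 2)).map Subtype.val (Icc 0 1)ᶜ = 0 := by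
    rw [map_val_unitLebesgue, Measure.restrict_apply measurableSet_Icc.compl, compl_inter_self,
      measure_empty]
  rwa [Measure.map_apply measurable_subtype_coe measurableSet_Icc.compl] at this

theorem concentrates_diracOne :
    Concentrates diracOne {x : Icc (0 : ℝ) 2 | (x : ℝ) ∈ Icc 0 1} := by
  apply concentrates_of_measure_compl_eq_zero
  have : (diracOne : Measure (Icc (0 : ℝ) 2)).map Subtype.val (Icc 0 1)ᶜ = 0 := by
    rw [map_val_diracOne, Measure.dirac_apply' _ measurableSet_Icc.compl]
    simp
  rwa [Measure.map_apply measurable_subtype_coe measurableSet_Icc.compl] at this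

theorem unitLebesgue_ne_diracOne : unitLebesgue ≠ diracOne := fun h => by
  have h1 := map_val_unitLebesgue
  rw [h, map_val_diracOne] at h1
  have h2 := congrArg (fun μ : Measure ℝ => μ {1}) h1
  simp at h2

/-! ### Rationalizability and RCBR in the indicator game -/

/-- In the game `G`, exactly the strategies in `[0, 1] \ A` are best responses to Lebesgue measure
on the unit interval, exactly those in `A` are best responses to the point mass at `1`, and no
strategy is a best response to another belief. -/
def IsIndicatorGame (A : Set ℝ) (G : Game fun _ => Icc (0 : ℝ) 2) : Prop :=
  ∀ (i : Player) (x : Icc (0 : ℝ) 2) (μ : ProbabilityMeasure (Icc (0 : ℝ) 2)),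
    (x, μ) ∈ G.bestResponse i ↔
      ((x : ℝ) ∈ Icc 0 1 \ A ∧
        (μ : Measure (Icc (0 : ℝ) 2)).map Subtype.val = volume.restrict (Icc 0 1)) ∨
      ((x : ℝ) ∈ A ∧ (μ : Measure (Icc (0 : ℝ) 2)).map Subtype.val = Measure.dirac 1)

section IndicatorGame

variable {A : Set ℝ} {G : Game fun _ => Icc (0 : ℝ) 2}

theorem IsIndicatorGame.mem_bestResponse_iff (hG : IsIndicatorGame A G) (i : Player)
    (x : Icc (0 : ℝ) 2) (μ : ProbabilityMeasure (Icc (0 : ℝ) 2)) :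
    (x, μ) ∈ G.bestResponse i ↔
      ((x : ℝ) ∈ Icc 0 1 \ A ∧ μ = unitLebesgue) ∨ ((x : ℝ) ∈ A ∧ μ = diracOne) := by
  rw [hG i x μ, ← map_val_unitLebesgue, ← map_val_diracOne]
  exact or_congr (and_congr_right fun _ => ⟨map_val_injective, fun h => by rw [h]⟩)
    (and_congr_right fun _ => ⟨map_val_injective, fun h => by rw [h]⟩)

/-- Both justifying beliefs live on `[0, 1]`. The cases `S = univ` and `S = [0, 1]` show that
deletion stops after one round. -/
theorem IsIndicatorGame.exists_bestResponse_iff (hG : IsIndicatorGame A G) (hA : A ⊆ Icc 0 1)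
    (i : Player) {S : Set (Icc (0 : ℝ) 2)} (hS : {x : Icc (0 : ℝ) 2 | (x : ℝ) ∈ Icc 0 1} ⊆ S)
    (x : Icc (0 : ℝ) 2) :
    (∃ μ : ProbabilityMeasure (Icc (0 : ℝ) 2), Concentrates μ S ∧ (x, μ) ∈ G.bestResponse i) ↔
      (x : ℝ) ∈ Icc 0 1 := by
  constructor
  · rintro ⟨μ, -, hμ⟩
    obtain h | h := (hG.mem_bestResponse_iff i x μ).1 hμ
    exacts [h.1.1, hA h.1]
  · intro hx
    by_cases hxA : (x : ℝ) ∈ A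
    · exact ⟨diracOne, concentrates_diracOne.mono hS,
        (hG.mem_bestResponse_iff i x _).2 (.inr ⟨hxA, rfl⟩)⟩
    · exact ⟨unitLebesgue, concentrates_unitLebesgue.mono hS,
        (hG.mem_bestResponse_iff i x _).2 (.inl ⟨⟨hx, hxA⟩, rfl⟩)⟩

theorem Game.survivors_zero {X : Player → Type} [∀ i, MeasurableSpace (X i)] (G : Game X)
    (i : Player) : G.survivors 0 i = univ := by
  rw [Game.survivors, Ordinal.limitRecOn_zero]

theorem Game.survivors_add_one {X : Player → Type} [∀ i, MeasurableSpace (X i)] (G : Game X)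
    (α : Ordinal.{0}) (i : Player) :
    G.survivors (α + 1) i = {s | s ∈ G.survivors α i ∧ ∃ μ : ProbabilityMeasure (X i.other),
      Concentrates μ (G.survivors α i.other) ∧ (s, μ) ∈ G.bestResponse i} := by
  rw [Game.survivors, Ordinal.limitRecOn_add_one]
  rfl

theorem IsIndicatorGame.survivors_one (hG : IsIndicatorGame A G) (hA : A ⊆ Icc 0 1) (i : Player) :
    G.survivors 1 i = {x : Icc (0 : ℝ) 2 | (x : ℝ) ∈ Icc 0 1} := by
  rw [← zero_add (1 : Ordinal), G.survivors_add_one, G.survivors_zero, G.survivors_zero]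
  ext x
  exact (and_iff_right (mem_univ x)).trans (hG.exists_bestResponse_iff hA i (subset_univ _) x)

theorem IsIndicatorGame.survivors_one_add_one (hG : IsIndicatorGame A G) (hA : A ⊆ Icc 0 1)
    (i : Player) : G.survivors (1 + 1) i = G.survivors 1 i := by
  rw [G.survivors_add_one, hG.survivors_one hA, hG.survivors_one hA]
  ext x
  exact and_iff_left_of_imp (hG.exists_bestResponse_iff hA i Subset.rfl x).2

theorem IsIndicatorGame.rationalizable_eq (hG : IsIndicatorGame A G) (hA : A ⊆ Icc 0 1)
    (i : Player) : G.rationalizable i = {x : Icc (0 : ℝ) 2 | (x : ℝ) ∈ Icc 0 1} := by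
  have hleast : IsLeast {α : Ordinal.{0} | ∀ j, G.survivors (α + 1) j = G.survivors α j} 1 := by
    refine ⟨hG.survivors_one_add_one hA, fun α hα => ?_⟩
    by_contra hlt
    obtain rfl : α = 0 := by simpa using hlt
    have h := hα i
    rw [zero_add, hG.survivors_one hA, G.survivors_zero] at h
    -- Stage `0` is not stationary: the strategy `2` is deleted at once.
    have h2 : (⟨2, zero_le_two, le_rfl⟩ : Icc (0 : ℝ) 2) ∈
        {x : Icc (0 : ℝ) 2 | (x : ℝ) ∈ Icc 0 1} := h ▸ mem_univ _
    exact absurd h2.2 (by norm_num)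
  rw [Game.rationalizable, hleast.csInf_eq, hG.survivors_one hA]

/-- A belief about the opponent's strategies and hierarchies that concentrates on rationality
yields measurable sets of strategies inside `[0, 1] \ A` and inside `A` that together carry the
belief. -/
theorem IsIndicatorGame.exists_measurableSets (hG : IsIndicatorGame A G) {i : Player}
    {ν : ProbabilityMeasure (Icc (0 : ℝ) 2 × Hierarchy (fun _ => Icc (0 : ℝ) 2) i)}
    (hν : Concentrates ν {p | (p.1, p.2.firstOrder) ∈ G.bestResponse i}) :
    ∃ C D : Set (Icc (0 : ℝ) 2), MeasurableSet C ∧ MeasurableSet D ∧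
      (∀ x ∈ C, (x : ℝ) ∈ Icc 0 1 \ A) ∧ (∀ x ∈ D, (x : ℝ) ∈ A) ∧
      ∀ᵐ p ∂(ν : Measure (Icc (0 : ℝ) 2 × Hierarchy (fun _ => Icc (0 : ℝ) 2) i)),
        (p.1 ∈ C ∧ p.2.firstOrder = unitLebesgue) ∨ (p.1 ∈ D ∧ p.2.firstOrder = diracOne) := by
  -- The event is measurable only for the completion; `B` is a measurable kernel of full measure.
  obtain ⟨B, hBE, hB, hBae⟩ := hν.1.exists_measurable_subset_ae_eq
  have hB0 : (ν : Measure (Icc (0 : ℝ) 2 × Hierarchy (fun _ => Icc (0 : ℝ) 2) i)) Bᶜ = 0 := by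
    rw [prob_compl_eq_zero_iff hB, measure_congr hBae, hν.2]
  have hm : ∀ μ : ProbabilityMeasure (Icc (0 : ℝ) 2), MeasurableSet
      {p : Icc (0 : ℝ) 2 × Hierarchy (fun _ => Icc (0 : ℝ) 2) i | p.2.firstOrder = μ} := fun μ =>
    measurableSet_preimage (t := {μ}) (measurable_firstOrder.comp measurable_snd)
      (measurableSet_singleton μ)
  obtain ⟨C, hCB, hC, hC0⟩ := exists_measurableSet_subset_image
    (ν : Measure (Icc (0 : ℝ) 2 × Hierarchy (fun _ => Icc (0 : ℝ) 2) i))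
    (hB.inter (hm unitLebesgue))
  obtain ⟨D, hDB, hD, hD0⟩ := exists_measurableSet_subset_image
    (ν : Measure (Icc (0 : ℝ) 2 × Hierarchy (fun _ => Icc (0 : ℝ) 2) i))
    (hB.inter (hm diracOne))
  refine ⟨C, D, hC, hD, fun x hx => ?_, fun x hx => ?_, ?_⟩
  · obtain ⟨p, ⟨hpB, hp⟩, rfl⟩ := hCB hx
    obtain h | h := (hG.mem_bestResponse_iff i _ _).1 (hBE hpB)
    exacts [h.1, absurd (hp.symm.trans h.2) unitLebesgue_ne_diracOne]
  · obtain ⟨p, ⟨hpB, hp⟩, rfl⟩ := hDB hx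
    obtain h | h := (hG.mem_bestResponse_iff i _ _).1 (hBE hpB)
    exacts [absurd (h.2.symm.trans hp) unitLebesgue_ne_diracOne, h.1]
  · filter_upwards [measure_eq_zero_iff_ae_notMem.1 hB0, measure_eq_zero_iff_ae_notMem.1 hC0,
      measure_eq_zero_iff_ae_notMem.1 hD0] with p hpB hpC hpD
    rw [notMem_compl_iff] at hpB
    obtain h | h := (hG.mem_bestResponse_iff i _ _).1 (hBE hpB)
    · exact .inl ⟨by_contra fun hp => hpC ⟨⟨hpB, h.2⟩, hp⟩, h.2⟩
    · exact .inr ⟨by_contra fun hp => hpD ⟨⟨hpB, h.2⟩, hp⟩, h.2⟩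

theorem IsIndicatorGame.exists_marginal_eq_unitLebesgue (hG : IsIndicatorGame A G)
    (hA : A ⊆ Icc 0 1) {i : Player} {x : Icc (0 : ℝ) 2} (hx : (x : ℝ) ∉ A) (hxG : x ∈ G.rcbr i) :
    (∃ ν : ProbabilityMeasure (Icc (0 : ℝ) 2 × ProbabilityMeasure (Icc (0 : ℝ) 2)),
      ν.map measurable_fst.aemeasurable = unitLebesgue ∧
      Concentrates ν (G.bestResponse i.other)) ∧ NullMeasurableSet A volume := by
  obtain ⟨ν, hxν, hν⟩ := Game.exists_concentrates_of_mem_rcbr hxG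
  have hmarg : ν.map measurable_fst.aemeasurable = unitLebesgue := by
    obtain h | h := (hG.mem_bestResponse_iff i _ _).1 hxν
    exacts [h.2, absurd h.1 hx]
  obtain ⟨C, D, hC, hD, hCA, hDA, hCD⟩ := hG.exists_measurableSets hν
  have hf : Measurable fun p : Icc (0 : ℝ) 2 × Hierarchy (fun _ => Icc (0 : ℝ) 2) i.other =>
      (p.1, p.2.firstOrder) :=
    measurable_fst.prodMk (measurable_firstOrder.comp measurable_snd)
  refine ⟨⟨ν.map hf.aemeasurable, ?_, ?_⟩, ?_⟩
  · rw [← hmarg]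
    exact Subtype.ext (Measure.map_map measurable_fst hf)
  -- The relation itself may fail to be measurable, so the image measure is concentrated on two
  -- measurable rectangles inside it.
  · have hCD' : MeasurableSet (C ×ˢ {unitLebesgue} ∪ D ×ˢ {diracOne}) :=
      (hC.prod (measurableSet_singleton _)).union (hD.prod (measurableSet_singleton _))
    refine Concentrates.mono (S := C ×ˢ {unitLebesgue} ∪ D ×ˢ {diracOne})
      (concentrates_of_measure_compl_eq_zero ?_) ?_
    · change Measure.map _
        (ν : Measure (Icc (0 : ℝ) 2 × Hierarchy (fun _ => Icc (0 : ℝ) 2) i.other)) _ = 0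
      rw [Measure.map_apply hf hCD'.compl]
      exact hCD
    · rintro ⟨y, μ⟩ (⟨hy, hμ⟩ | ⟨hy, hμ⟩)
      · exact (hG.mem_bestResponse_iff _ y μ).2 (.inl ⟨hCA y hy, hμ⟩)
      · exact (hG.mem_bestResponse_iff _ y μ).2 (.inr ⟨hDA y hy, hμ⟩)
  · have he := MeasurableEmbedding.subtype_coe (measurableSet_Icc (a := (0 : ℝ)) (b := 2))
    have hCD0 : (unitLebesgue : Measure (Icc (0 : ℝ) 2)) (C ∪ D)ᶜ = 0 := by
      rw [← hmarg]
      change Measure.map _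
        (ν : Measure (Icc (0 : ℝ) 2 × Hierarchy (fun _ => Icc (0 : ℝ) 2) i.other)) _ = 0
      rw [Measure.map_apply measurable_fst (hC.union hD).compl]
      refine measure_eq_zero_iff_ae_notMem.2 (hCD.mono fun p hp hpCD => hpCD ?_)
      exact hp.imp And.left And.left
    have hnull : volume (Icc (0 : ℝ) 1 \ Subtype.val '' (C ∪ D)) = 0 := by
      have hmeas := he.measurableSet_image.2 (hC.union hD)
      rw [Set.sdiff_eq, inter_comm, ← Measure.restrict_apply hmeas.compl, ← map_val_unitLebesgue,
        Measure.map_apply measurable_subtype_coe hmeas.compl, preimage_compl,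
        preimage_image_eq _ Subtype.val_injective]
      exact hCD0
    have hDsub : Subtype.val '' D ⊆ A := image_subset_iff.2 hDA
    -- Since `C` misses `A`, the part of `A` outside `D` lies in the null set of `hnull`.
    rw [← union_sdiff_cancel hDsub]
    refine (he.measurableSet_image.2 hD).nullMeasurableSet.union (.of_null ?_)
    have hsub : A \ Subtype.val '' D ⊆ Icc (0 : ℝ) 1 \ Subtype.val '' (C ∪ D) := by
      refine fun y hy => ⟨hA hy.1, ?_⟩
      rintro ⟨z, hz | hz, rfl⟩
      · exact (hCA z hz).2 hy.1
      · exact hy.2 (mem_image_of_mem _ hz)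
    exact measure_mono_null hsub hnull

end IndicatorGame

/-! ### Reduction to the unit interval -/

/-- Integer translates of `(0, 1]` tile the line. The half-open interval keeps `0` available as a
strategy outside `A`. -/
theorem nullMeasurableSet_of_forall_subset_Ioc
    (h : ∀ A : Set ℝ, A ⊆ Ioc 0 1 → NullMeasurableSet A volume) (A : Set ℝ) :
    NullMeasurableSet A volume := by
  have hA : A = ⋃ n : ℤ, (fun x : ℝ => x - n) ⁻¹' {y | y ∈ Ioc 0 1 ∧ y + n ∈ A} := by
    ext x
    simp only [mem_iUnion, mem_preimage, mem_ofPred_eq, sub_add_cancel]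
    refine ⟨fun hx => ⟨⌈x⌉ - 1, ?_, hx⟩, fun ⟨_, _, hx⟩ => hx⟩
    push_cast
    constructor <;> linarith [Int.le_ceil x, Int.ceil_lt_add_one x]
  rw [hA]
  exact .iUnion fun n => (h _ fun y hy => hy.1).preimage
    (measurePreserving_sub_right volume (n : ℝ)).quasiMeasurePreserving

/-! ### Test payoffs -/

/-- Payoffs, indexed by the natural numbers, of strategies that together detect whether a measure
on the real line differs from Lebesgue measure on the unit interval and from the point mass
at `1`. -/
noncomputable def testPayoff : Option (ℚ × Bool) → ℝ → ℝ
  | none, y => indicator {1} 1 y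
  | some (q, true), y =>
    indicator (Iic (q : ℝ)) 1 y - (volume.restrict (Icc 0 1)).real (Iic (q : ℝ))
  | some (q, false), y =>
    (volume.restrict (Icc 0 1)).real (Iic (q : ℝ)) - indicator (Iic (q : ℝ)) 1 y

/-- The expectation of `testPayoff`. -/
noncomputable def expectedTestPayoff : Option (ℚ × Bool) → Measure ℝ → ℝ
  | none, μ => μ.real {1}
  | some (q, true), μ => μ.real (Iic (q : ℝ)) - (volume.restrict (Icc 0 1)).real (Iic (q : ℝ))
  | some (q, false), μ => (volume.restrict (Icc 0 1)).real (Iic (q : ℝ)) - μ.real (Iic (q : ℝ))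

instance isProbabilityMeasure_restrict_unitInterval :
    IsProbabilityMeasure (volume.restrict (Icc (0 : ℝ) 1)) := ⟨by simp⟩

theorem measurable_testPayoff (j : Option (ℚ × Bool)) : Measurable (testPayoff j) := by
  have hq : ∀ q : ℚ, Measurable (indicator (Iic (q : ℝ)) (1 : ℝ → ℝ)) := fun q =>
    measurable_one.indicator measurableSet_Iic
  rcases j with _ | ⟨q, _ | _⟩
  exacts [measurable_one.indicator (measurableSet_singleton 1), (hq q).const_sub _,
    (hq q).sub_const _]

theorem indicator_one_mem_Icc (S : Set ℝ) (y : ℝ) : indicator S (1 : ℝ → ℝ) y ∈ Icc (0 : ℝ) 1 :=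
  ⟨indicator_nonneg (fun _ _ => zero_le_one) y, indicator_le_self' (fun _ _ => zero_le_one) y⟩

theorem abs_testPayoff_le (j : Option (ℚ × Bool)) (y : ℝ) : |testPayoff j y| ≤ 1 := by
  have hv : ∀ q : ℚ, (volume.restrict (Icc (0 : ℝ) 1)).real (Iic (q : ℝ)) ∈ Icc (0 : ℝ) 1 :=
    fun q => ⟨measureReal_nonneg, measureReal_le_one⟩
  rw [abs_le]
  rcases j with _ | ⟨q, _ | _⟩
  · have h := indicator_one_mem_Icc {1} y
    constructor <;> simp only [testPayoff] <;> linarith [h.1, h.2]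
  all_goals
    have h := indicator_one_mem_Icc (Iic (q : ℝ)) y
    constructor <;> simp only [testPayoff] <;> linarith [h.1, h.2, (hv q).1, (hv q).2]

theorem integral_testPayoff (j : Option (ℚ × Bool)) (μ : Measure ℝ) [IsProbabilityMeasure μ] :
    ∫ y, testPayoff j y ∂μ = expectedTestPayoff j μ := by
  have hint : ∀ q : ℚ, Integrable (indicator (Iic (q : ℝ)) (1 : ℝ → ℝ)) μ := fun q =>
    (integrable_const (1 : ℝ)).indicator measurableSet_Iic
  rcases j with _ | ⟨q, _ | _⟩
  · exact integral_indicator_one (measurableSet_singleton 1)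
  · simp only [testPayoff, expectedTestPayoff]
    rw [integral_sub (integrable_const _) (hint q), integral_indicator_one measurableSet_Iic]
    simp
  · simp only [testPayoff, expectedTestPayoff]
    rw [integral_sub (hint q) (integrable_const _), integral_indicator_one measurableSet_Iic]
    simp

theorem expectedTestPayoff_restrict_unitInterval (j : Option (ℚ × Bool)) :
    expectedTestPayoff j (volume.restrict (Icc 0 1)) = 0 := by
  rcases j with _ | ⟨q, _ | _⟩ <;> simp [expectedTestPayoff, measureReal_def]

theorem expectedTestPayoff_le_one (j : Option (ℚ × Bool)) (μ : Measure ℝ)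
    [IsProbabilityMeasure μ] : expectedTestPayoff j μ ≤ 1 := by
  rw [← integral_testPayoff]
  have hint : Integrable (testPayoff j) μ :=
    .of_bound (measurable_testPayoff j).aestronglyMeasurable 1
      (.of_forall fun y => abs_testPayoff_le j y)
  refine (integral_mono hint (integrable_const 1) fun y => ?_).trans_eq (by simp)
  exact (abs_le.1 (abs_testPayoff_le j y)).2

/-- The two signs of each test fix the mass of every rational half-line, and these form a generating
π-system. -/
theorem eq_restrict_unitInterval_of_expectedTestPayoff (μ : Measure ℝ) [IsProbabilityMeasure μ]
    (h : ∀ j, expectedTestPayoff (some j) μ ≤ 0) : μ = volume.restrict (Icc 0 1) := by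
  refine ext_of_generate_finite _ Real.borel_eq_generateFrom_Iic_rat Real.isPiSystem_Iic_rat
    ?_ (by rw [measure_univ, measure_univ])
  intro s hs
  obtain ⟨q, rfl⟩ := mem_iUnion.1 hs
  have h1 := h (q, true)
  have h2 := h (q, false)
  simp only [expectedTestPayoff] at h1 h2
  exact (measureReal_eq_measureReal_iff).1 (le_antisymm (by linarith) (by linarith))

theorem eq_dirac_of_one_le_measureReal_singleton {μ : Measure ℝ} [IsProbabilityMeasure μ] {x : ℝ}
    (h : 1 ≤ μ.real {x}) : μ = Measure.dirac x := by
  have h1 : μ {x}ᶜ = 0 := by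
    rw [prob_compl_eq_zero_iff (measurableSet_singleton x)]
    refine le_antisymm prob_le_one ?_
    rw [← ofReal_measureReal]
    simpa using ENNReal.ofReal_le_ofReal h
  ext s hs
  by_cases hx : x ∈ s
  · rw [Measure.dirac_apply_of_mem hx, ← prob_compl_eq_zero_iff hs]
    exact measure_mono_null (compl_subset_compl.2 (singleton_subset_iff.2 hx)) h1
  · rw [Measure.dirac_apply' _ hs, indicator_of_notMem hx]
    exact measure_mono_null (fun y hy (hyx : y = x) => hx (hyx ▸ hy)) h1

theorem exists_surjOn_Ioc (ι : Type) [Nonempty ι] [Countable ι] :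
    ∃ φ : ℝ → ι, ∀ k, ∃ x ∈ Ioc (1 : ℝ) 2, φ x = k := by
  obtain ⟨f, hf⟩ := exists_surjective_nat ι
  -- The point `1 + 1/(n + 1)` codes `n`.
  refine ⟨fun x => f (⌊(x - 1)⁻¹⌋₊ - 1), fun k => ?_⟩
  obtain ⟨n, rfl⟩ := hf k
  have hn : (0 : ℝ) < n + 1 := by positivity
  refine ⟨1 + ((n : ℝ) + 1)⁻¹, ⟨by linarith [inv_pos.2 hn], ?_⟩, ?_⟩
  · have : ((n : ℝ) + 1)⁻¹ ≤ 1 :=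
      inv_le_one_of_one_le₀ (by linarith [(n.cast_nonneg : (0 : ℝ) ≤ n)])
    linarith
  · have : ⌊(n : ℝ) + 1⌋₊ = n + 1 := by exact_mod_cast Nat.floor_natCast (n + 1)
    simp [this]

/-! ### Construction of the indicator game -/

open scoped Classical in
/-- The payoff of the strategy `x` against the strategy `y`. -/
noncomputable def indicatorPayoff (A : Set ℝ) (φ : ℝ → Option (ℚ × Bool) × ℕ) (x y : ℝ) : ℝ :=
  if x ∈ A then 2 * testPayoff none y - 1
  else if x ≤ 1 then 0
  else testPayoff (φ x).1 y - ((φ x).2 + 1 : ℝ)⁻¹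

section IndicatorPayoff

variable {A : Set ℝ} {φ : ℝ → Option (ℚ × Bool) × ℕ}

theorem measurable_indicatorPayoff (x : ℝ) : Measurable (indicatorPayoff A φ x) := by
  unfold indicatorPayoff
  split_ifs
  exacts [((measurable_testPayoff none).const_mul 2).sub_const 1, measurable_const,
    (measurable_testPayoff _).sub_const _]

theorem abs_indicatorPayoff_le (x y : ℝ) : |indicatorPayoff A φ x y| ≤ 3 := by
  have h := fun j => abs_le.1 (abs_testPayoff_le j y)
  have hn : ((φ x).2 + 1 : ℝ)⁻¹ ∈ Icc (0 : ℝ) 1 :=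
    ⟨by positivity, inv_le_one_of_one_le₀ (by simp)⟩
  rw [abs_le]
  unfold indicatorPayoff
  split_ifs
  · constructor <;> linarith [(h none).1, (h none).2]
  · constructor <;> norm_num
  · constructor <;> linarith [(h (φ x).1).1, (h (φ x).1).2, hn.1, hn.2]

open scoped Classical in
theorem integral_indicatorPayoff (x : ℝ) (μ : Measure ℝ) [IsProbabilityMeasure μ] :
    ∫ y, indicatorPayoff A φ x y ∂μ =
      if x ∈ A then 2 * μ.real {1} - 1
      else if x ≤ 1 then 0
      else expectedTestPayoff (φ x).1 μ - ((φ x).2 + 1 : ℝ)⁻¹ := by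
  have hint : ∀ j, Integrable (testPayoff j) μ := fun j =>
    .of_bound (measurable_testPayoff j).aestronglyMeasurable 1
      (.of_forall fun y => abs_testPayoff_le j y)
  unfold indicatorPayoff
  split_ifs
  · rw [integral_sub ((hint none).const_mul 2) (integrable_const 1), integral_const_mul,
      integral_testPayoff]
    simp [expectedTestPayoff]
  · simp
  · rw [integral_sub (hint _) (integrable_const _), integral_testPayoff]
    simp

/-- The symmetric game with payoff `indicatorPayoff`. -/
noncomputable def indicatorGame (A : Set ℝ) (φ : ℝ → Option (ℚ × Bool) × ℕ) :
    Game fun _ => Icc (0 : ℝ) 2 where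
  payoff _ x y := indicatorPayoff A φ x y
  bounded _ := ⟨3, fun _ _ => abs_indicatorPayoff_le _ _⟩
  section_measurable _ x _ :=
    ((measurable_indicatorPayoff (x : ℝ)).comp measurable_subtype_coe).nullMeasurable

theorem expectedPayoff_indicatorGame (i : Player) (x : Icc (0 : ℝ) 2)
    (μ : ProbabilityMeasure (Icc (0 : ℝ) 2)) :
    (indicatorGame A φ).expectedPayoff i x μ =
      ∫ y, indicatorPayoff A φ x y ∂((μ : Measure (Icc (0 : ℝ) 2)).map Subtype.val) := by
  rw [(MeasurableEmbedding.subtype_coe measurableSet_Icc).integral_map]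
  rfl

theorem isIndicatorGame_indicatorGame (hA : A ⊆ Icc 0 1)
    (hφ : ∀ k, ∃ x ∈ Ioc (1 : ℝ) 2, φ x = k) : IsIndicatorGame A (indicatorGame A φ) := by
  intro i x μ
  have hm := Measure.isProbabilityMeasure_map (μ := (μ : Measure (Icc (0 : ℝ) 2)))
    (f := Subtype.val) measurable_subtype_coe.aemeasurable
  change (∀ t : Icc (0 : ℝ) 2, (indicatorGame A φ).expectedPayoff i t μ ≤
    (indicatorGame A φ).expectedPayoff i x μ) ↔ _
  simp only [expectedPayoff_indicatorGame, integral_indicatorPayoff]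
  generalize (μ : Measure (Icc (0 : ℝ) 2)).map Subtype.val = m at hm ⊢
  constructor
  · intro h
    have htest : ∀ j (n : ℕ), ∃ t : Icc (0 : ℝ) 2, (t : ℝ) ∉ A ∧ ¬ (t : ℝ) ≤ 1 ∧ φ t = (j, n) :=
      fun j n => by
        obtain ⟨t, ht, htk⟩ := hφ (j, n)
        exact ⟨⟨t, zero_le_one.trans ht.1.le, ht.2⟩, fun htA => (hA htA).2.not_gt ht.1,
          ht.1.not_ge, htk⟩
    -- Every test is available with arbitrarily small penalty, so a best response earns at least the
    -- unpenalized test value.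
    have hge : ∀ j, ∀ c : ℝ, (∀ n : ℕ, expectedTestPayoff j m - (n + 1 : ℝ)⁻¹ ≤ c) →
        expectedTestPayoff j m ≤ c := fun j c hc => by
      refine le_of_forall_pos_lt_add fun ε hε => ?_
      obtain ⟨n, hn⟩ := exists_nat_one_div_lt hε
      rw [one_div] at hn
      linarith [hc n]
    by_cases hxA : (x : ℝ) ∈ A
    · refine .inr ⟨hxA, eq_dirac_of_one_le_measureReal_singleton ?_⟩
      -- With `p` the mass at `1`, optimality in `A` gives `p ≤ 2p - 1`, hence `p ≥ 1`.
      have := hge none (2 * m.real {1} - 1) fun n => by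
        obtain ⟨t, htA, ht1, ht⟩ := htest none n
        simpa [htA, ht1, ht, hxA] using h t
      simp only [expectedTestPayoff] at this
      linarith
    · by_cases hx1 : (x : ℝ) ≤ 1
      · refine .inl ⟨⟨⟨x.2.1, hx1⟩, hxA⟩, eq_restrict_unitInterval_of_expectedTestPayoff _ ?_⟩
        intro j
        refine hge (some j) 0 fun n => ?_
        obtain ⟨t, htA, ht1, ht⟩ := htest (some j) n
        simpa [htA, ht1, ht, hxA, hx1] using h t
      -- A strategy above `1` is never optimal: the same test exists with a smaller penalty.
      · have := hge (φ x).1 (expectedTestPayoff (φ x).1 m - ((φ x).2 + 1 : ℝ)⁻¹) fun n => by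
          obtain ⟨t, htA, ht1, ht⟩ := htest (φ x).1 n
          simpa [htA, ht1, ht, hxA, hx1] using h t
        have hpos : 0 < ((φ x).2 + 1 : ℝ)⁻¹ := by positivity
        linarith
  · have hpos : ∀ t : Icc (0 : ℝ) 2, 0 < ((φ t).2 + 1 : ℝ)⁻¹ := fun t => by positivity
    -- Against Lebesgue measure, `A` earns `-1` and the tests less than `0`; against the point mass,
    -- `A` earns `1` and the tests less than `1`.
    rintro (⟨⟨hx, hxA⟩, rfl⟩ | ⟨hxA, rfl⟩) t
    · rw [if_neg hxA, if_pos hx.2]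
      split_ifs
      · simp [measureReal_def]
      · exact le_rfl
      · rw [expectedTestPayoff_restrict_unitInterval]
        linarith [hpos t]
    · rw [if_pos hxA]
      have h1 : (Measure.dirac (1 : ℝ)).real {1} = 1 := by simp [measureReal_def]
      rw [h1]
      split_ifs
      · exact le_rfl
      · norm_num
      · linarith [hpos t, expectedTestPayoff_le_one (φ t).1 (Measure.dirac (1 : ℝ))]

end IndicatorPayoff

theorem theorem8p5 :
    -- if rationalizability is equivalent to RCBR in all games, all sets are Lebesgue measurable
    ((∀ (X : Player → Type) [∀ i, TopologicalSpace (X i)] [∀ i, PolishSpace (X i)]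
        [∀ i, MeasurableSpace (X i)] [∀ i, BorelSpace (X i)] (G : Game X) (i : Player),
        G.rationalizable i = G.rcbr i) →
      ∀ A : Set ℝ, NullMeasurableSet A volume) ∧
    -- the game attached to an individual subset of the unit interval
    (∀ A : Set ℝ, A ⊆ Icc 0 1 →
      ∃ G : Game (fun _ => Icc (0 : ℝ) 2),
        G.payoff .one = G.payoff .two ∧
        (∀ i x, Measurable (G.payoff i x)) ∧
        (∀ (i : Player) (x : Icc (0 : ℝ) 2) (μ : ProbabilityMeasure (Icc (0 : ℝ) 2)),
          (x, μ) ∈ G.bestResponse i ↔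
            ((x : ℝ) ∈ Icc 0 1 \ A ∧
              (μ : Measure (Icc (0 : ℝ) 2)).map Subtype.val = volume.restrict (Icc 0 1)) ∨
            ((x : ℝ) ∈ A ∧
              (μ : Measure (Icc (0 : ℝ) 2)).map Subtype.val = Measure.dirac 1)) ∧
        (∀ i, G.rationalizable i = {x : Icc (0 : ℝ) 2 | (x : ℝ) ∈ Icc 0 1}) ∧
        ∀ (i : Player) (x : Icc (0 : ℝ) 2), (x : ℝ) ∈ Icc 0 1 \ A → x ∈ G.rcbr i →
          (∃ ν : ProbabilityMeasure (Icc (0 : ℝ) 2 × ProbabilityMeasure (Icc (0 : ℝ) 2)),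
            (ν.map measurable_fst.aemeasurable : Measure (Icc (0 : ℝ) 2)).map Subtype.val =
              volume.restrict (Icc 0 1) ∧
            Concentrates ν (G.bestResponse i.other)) ∧
          NullMeasurableSet A volume) := by
  have hgame : ∀ A : Set ℝ, A ⊆ Icc 0 1 → ∃ G : Game (fun _ => Icc (0 : ℝ) 2),
      G.payoff .one = G.payoff .two ∧ (∀ i x, Measurable (G.payoff i x)) ∧
      IsIndicatorGame A G := fun A hA => by
    obtain ⟨φ, hφ⟩ := exists_surjOn_Ioc (Option (ℚ × Bool) × ℕ)
    exact ⟨indicatorGame A φ, rfl,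
      fun _ x => (measurable_indicatorPayoff (x : ℝ)).comp measurable_subtype_coe,
      isIndicatorGame_indicatorGame hA hφ⟩
  refine ⟨fun h => nullMeasurableSet_of_forall_subset_Ioc fun A hA => ?_, fun A hA => ?_⟩
  · have hA' : A ⊆ Icc 0 1 := hA.trans Ioc_subset_Icc_self
    obtain ⟨G, -, -, hG⟩ := hgame A hA'
    refine (hG.exists_marginal_eq_unitLebesgue hA' (i := .one)
      (x := ⟨0, le_rfl, zero_le_two⟩) (fun h0 => (hA h0).1.false) ?_).2
    rw [← h _ G, hG.rationalizable_eq hA']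
    exact ⟨le_rfl, zero_le_one⟩
  · obtain ⟨G, hsymm, hmeas, hG⟩ := hgame A hA
    refine ⟨G, hsymm, hmeas, hG, hG.rationalizable_eq hA, fun i x hx hxG => ?_⟩
    obtain ⟨⟨ν, hν, hνE⟩, hAm⟩ := hG.exists_marginal_eq_unitLebesgue hA hx.2 hxG
    exact ⟨⟨ν, by rw [hν, map_val_unitLebesgue], hνE⟩, hAm⟩
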